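/- \textbf{Theorem ($\mathsf{LNS}_{\mathsf{KB}}$ is sound and complete).} Fix a set of atoms, and let formulae be given by $A ::= p \mid \bot \mid A\to A \mid \Box A$, with $\neg,\wedge,\vee$ defined as usual and $\Diamond A := \neg\Box\neg A$. The logic $\mathsf{KB}$ is the set of formulae that are forced at every world of every Kripke model whose accessibility relation is symmetric. A linear nested sequent is a non-empty finite sequence $\Gamma_1\Rightarrow\Delta_1\nearrow\cdots\nearrow\Gamma_n\Rightarrow\Delta_n$, where the $\Gamma_i,\Delta_i$ are finite multisets of formulae. Its formula translation is $\tau(\Gamma\Rightarrow\Delta)=\bigwedge\Gamma\to\bigvee\Delta$ and $\tau(\Gamma\Rightarrow\Delta\nearrow S)=\bigwedge\Gamma\to(\bigvee\Delta\vee\Box\,\tau(S))$, with empty conjunction $\top$ and empty disjunction $\bot$. It is called valid if $\tau(S)\in\mathsf{KB}$. The calculus $\mathsf{LNS}_{\mathsf{KB}}$ has the following rules (premisses / conclusion), where $\mathcal G$ is a possibly empty context (but non-empty in $\mathsf{EW}$): \begin{itemize} \item $(\mathrm{id})$: no premiss / $\mathcal G\nearrow\Gamma,p\Rightarrow p,\Delta$,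 with $p$ an atom; \item $(\bot_L)$: no premiss / $\mathcal G\nearrow\Gamma,\bot\Rightarrow\Delta$; \item $(\to_R)$: $\mathcal G\nearrow\Gamma,A\Rightarrow\Delta,A\to B,B$ / $\mathcal G\nearrow\Gamma\Rightarrow\Delta,A\to B$; \item $(\to_L)$: $\mathcal G\nearrow\Gamma,A\to B,B\Rightarrow\Delta$ and $\mathcal G\nearrow\Gamma,A\to B\Rightarrow\Delta,A$ / $\mathcal G\nearrow\Gamma,A\to B\Rightarrow\Delta$; \item $(\mathsf{EW})$: $\mathcal G$ / $\mathcal G\nearrow\Gamma\Rightarrow\Delta$; \item $(\Box_R)$: $\mathcal G\nearrow\Gamma\Rightarrow\Delta,\Box A\nearrow\ \Rightarrow A$ / $\mathcal G\nearrow\Gamma\Rightarrow\Delta,\Box A$; \item $(\Box_L^1)$: $\mathcal G\nearrow\Gamma,\Box A\Rightarrow\Delta\nearrow\Sigma,A\Rightarrow\Pi$ / $\mathcal G\nearrow\Gamma,\Box A\Rightarrow\Delta\nearrow\Sigma\Rightarrow\Pi$; \item $(\Box_L^2)$: $\mathcal G\nearrow\Gamma,A\Rightarrow\Delta$ / $\mathcal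 G\nearrow\Gamma\Rightarrow\Delta\nearrow\Sigma,\Box A\Rightarrow\Pi$. \end{itemize} Then: \begin{enumerate} \item (Soundness) every linear nested sequent derivable in $\mathsf{LNS}_{\mathsf{KB}}$ is valid; \item (Completeness) every valid one-component sequent $\Gamma\Rightarrow\Delta$ is derivable in $\mathsf{LNS}_{\mathsf{KB}}$. \end{enumerate} In particular, for every formula $A$, the sequent $\ \Rightarrow A$ is derivable in $\mathsf{LNS}_{\mathsf{KB}}$ if and only if $A\in\mathsf{KB}$. -/

import Mathlib

universe u w

namespace LNSKB

/-- Formulae of mono-modal logic over a set of atoms. The other connectives and the diamond are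
defined as usual from these. -/
inductive Formula (Atm : Type u) : Type u
  | atom (p : Atm) : Formula Atm
  | bot : Formula Atm
  | imp (A B : Formula Atm) : Formula Atm
  | box (A : Formula Atm) : Formula Atm

namespace Formula

variable {Atm : Type u}

def neg (A : Formula Atm) : Formula Atm := imp A bot

def top : Formula Atm := neg bot

def and (A B : Formula Atm) : Formula Atm := neg (imp A (neg B))

def or (A B : Formula Atm) : Formula Atm := imp (neg A) B

def dia (A : Formula Atm) : Formula Atm := neg (box (neg A))

/-- The conjunction of a finite multiset of formulae, taken in some order; the empty conjunction
is `top`. -/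
noncomputable def conj (Γ : Multiset (Formula Atm)) : Formula Atm :=
  Γ.toList.foldr and top

/-- The disjunction of a finite multiset of formulae, taken in some order; the empty disjunction
is `bot`. -/
noncomputable def disj (Δ : Multiset (Formula Atm)) : Formula Atm :=
  Δ.toList.foldr or bot

end Formula

/-- Kripke models: a non-empty set of worlds, a binary relation and a valuation. -/
structure KripkeModel (Atm : Type u) where
  World : Type w
  nonempty : Nonempty World
  R : World → World → Prop
  V : World → Atm → Prop

namespace KripkeModel

variable {Atm : Type u}

/-- The underlying frame is symmetric. -/
def IsSymmetric (M : KripkeModel.{u, w} Atm) : Prop :=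
  ∀ x y : M.World, M.R x y → M.R y x

/-- The forcing relation. -/
def Forces (M : KripkeModel.{u, w} Atm) : M.World → Formula Atm → Prop
  | x, .atom p => M.V x p
  | _, .bot => False
  | x, .imp A B => M.Forces x A → M.Forces x B
  | x, .box A => ∀ y : M.World, M.R x y → M.Forces y A

variable (M : KripkeModel.{u, w} Atm) (x : M.World)

theorem forces_neg (A : Formula Atm) : M.Forces x A.neg ↔ ¬ M.Forces x A := by
  simp [Formula.neg, Forces]

theorem forces_top : M.Forces x Formula.top := by
  simp [Formula.top, Formula.neg, Forces]

theorem forces_and (A B : Formula Atm) :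
    M.Forces x (A.and B) ↔ M.Forces x A ∧ M.Forces x B := by
  simp [Formula.and, Formula.neg, Forces]

theorem forces_or (A B : Formula Atm) :
    M.Forces x (A.or B) ↔ M.Forces x A ∨ M.Forces x B := by
  simp only [Formula.or, Formula.neg, Forces]; tauto

theorem forces_dia (A : Formula Atm) :
    M.Forces x A.dia ↔ ∃ y : M.World, M.R x y ∧ M.Forces y A := by
  simp [Formula.dia, Formula.neg, Forces]

theorem forces_conj (Γ : Multiset (Formula Atm)) :
    M.Forces x (Formula.conj Γ) ↔ ∀ A ∈ Γ, M.Forces x A := by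
  have h : ∀ l : List (Formula Atm),
      M.Forces x (l.foldr Formula.and Formula.top) ↔ ∀ A ∈ l, M.Forces x A := by
    intro l
    induction l with
    | nil => simp [forces_top]
    | cons a l ih => simp [forces_and, ih]
  simpa [Formula.conj] using h Γ.toList

theorem forces_disj (Δ : Multiset (Formula Atm)) :
    M.Forces x (Formula.disj Δ) ↔ ∃ A ∈ Δ, M.Forces x A := by
  have h : ∀ l : List (Formula Atm),
      M.Forces x (l.foldr Formula.or Formula.bot) ↔ ∃ A ∈ l, M.Forces x A := by
    intro l
    induction l with
    | nil => simp [Forces]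
    | cons a l ih => simp [forces_or, ih]
  simpa [Formula.disj] using h Δ.toList

end KripkeModel

/-- The logic `KB`: the formulae forced at all worlds of all models over symmetric frames (with
worlds in the universe `w`). -/
def KB (Atm : Type u) : Set (Formula Atm) :=
  {A | ∀ M : KripkeModel.{u, w} Atm, M.IsSymmetric → ∀ x : M.World, M.Forces x A}

/-- A component `Γ ⇒ Δ`: a pair of finite multisets of formulae. -/
structure Component (Atm : Type u) : Type u where
  ant : Multiset (Formula Atm)
  suc : Multiset (Formula Atm)

/-- Linear nested sequents: `S := Γ ⇒ Δ | Γ ⇒ Δ ↗ S`. -/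
inductive LNS (Atm : Type u) : Type u
  | single (c : Component Atm) : LNS Atm
  | cons (c : Component Atm) (S : LNS Atm) : LNS Atm

namespace LNS

variable {Atm : Type u}

/-- `plug G S` is `G ↗ S` for a possibly empty context `G`. -/
def plug : List (Component Atm) → LNS Atm → LNS Atm
  | [], S => S
  | c :: G, S => cons c (plug G S)

/-- `G ↗ Γ ⇒ Δ`. -/
def end1 (G : List (Component Atm)) (Γ Δ : Multiset (Formula Atm)) : LNS Atm :=
  plug G (single ⟨Γ, Δ⟩)

/-- `G ↗ Γ ⇒ Δ ↗ Σ ⇒ Π`. -/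
def end2 (G : List (Component Atm)) (Γ Δ Sg Pi : Multiset (Formula Atm)) : LNS Atm :=
  plug G (cons ⟨Γ, Δ⟩ (single ⟨Sg, Pi⟩))

/-- The formula translation. -/
noncomputable def toFormula : LNS Atm → Formula Atm
  | single c => (Formula.conj c.ant).imp (Formula.disj c.suc)
  | cons c S => (Formula.conj c.ant).imp ((Formula.disj c.suc).or (toFormula S).box)

/-- A linear nested sequent is falsifiable (over symmetric frames) if its formula translation
fails at some world of some symmetric model. -/
def Falsifiable (S : LNS Atm) : Prop :=
  ∃ M : KripkeModel.{u, w} Atm, M.IsSymmetric ∧ ∃ x : M.World, ¬ M.Forces x S.toFormula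

/-- A linear nested sequent is valid (over symmetric frames) if it is not falsifiable. -/
def Valid (S : LNS Atm) : Prop := ¬ Falsifiable.{u, w} S

end LNS

open Formula LNS in
/-- Derivability in the calculus `LNS_KB`. In each rule `G` is a possibly empty context. In the
rule `ew` the premiss is a linear nested sequent, so it has at least one component. -/
inductive Derivable {Atm : Type u} : LNS Atm → Prop
  | id (G : List (Component Atm)) (Γ Δ : Multiset (Formula Atm)) (p : Atm) :
      Derivable (end1 G (atom p ::ₘ Γ) (atom p ::ₘ Δ))
  | botL (G : List (Component Atm)) (Γ Δ : Multiset (Formula Atm)) :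
      Derivable (end1 G (bot ::ₘ Γ) Δ)
  | ew (G : List (Component Atm)) (Γ Δ Sg Pi : Multiset (Formula Atm)) :
      Derivable (end1 G Γ Δ) →
      Derivable (end2 G Γ Δ Sg Pi)
  | impR (G : List (Component Atm)) (Γ Δ : Multiset (Formula Atm)) (A B : Formula Atm) :
      Derivable (end1 G (A ::ₘ Γ) (B ::ₘ imp A B ::ₘ Δ)) →
      Derivable (end1 G Γ (imp A B ::ₘ Δ))
  | impL (G : List (Component Atm)) (Γ Δ : Multiset (Formula Atm)) (A B : Formula Atm) :
      Derivable (end1 G (B ::ₘ imp A B ::ₘ Γ) Δ) →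
      Derivable (end1 G (imp A B ::ₘ Γ) (A ::ₘ Δ)) →
      Derivable (end1 G (imp A B ::ₘ Γ) Δ)
  | boxR (G : List (Component Atm)) (Γ Δ : Multiset (Formula Atm)) (A : Formula Atm) :
      Derivable (end2 G Γ (box A ::ₘ Δ) 0 {A}) →
      Derivable (end1 G Γ (box A ::ₘ Δ))
  | boxL1 (G : List (Component Atm)) (Γ Δ Sg Pi : Multiset (Formula Atm)) (A : Formula Atm) :
      Derivable (end2 G (box A ::ₘ Γ) Δ (A ::ₘ Sg) Pi) →
      Derivable (end2 G (box A ::ₘ Γ) Δ Sg Pi)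
  | boxL2 (G : List (Component Atm)) (Γ Δ Sg Pi : Multiset (Formula Atm)) (A : Formula Atm) :
      Derivable (end1 G (A ::ₘ Γ) Δ) →
      Derivable (end2 G Γ Δ (box A ::ₘ Sg) Pi)

end LNSKB

namespace LNSKB

variable {Atm : Type u}

/-! ### Soundness -/

/-! Soundness: in a fixed symmetric model, every rule preserves being forced at all worlds. Only the
end of a sequent is rewritten, so a check at the end lifts through the context
(`forces_plug_mono₂`). Completeness: an underivable sequent is refuted in a canonical model. Over a
finite subformula-closed set `F`, a world is a context together with a maximal underivable last
component, and worlds are adjacent when one extends the other by one component, so symmetry is built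
in. Read backwards, the rules give the truth lemma `canonicalModel_truth`: `boxR` creates a child,
`boxL1` sends boxed formulae on the left down to children, `boxL2` sends them up to the parent.
Maximality compares only underlying sets, so weakening and contraction need not be proved
admissible. The model may be infinite but is countable, hence has a copy in any universe. -/

theorem exists_mem_cons_iff {α : Type*} {P : α → Prop} {a : α} {s : Multiset α} :
    (∃ x ∈ a ::ₘ s, P x) ↔ P a ∨ ∃ x ∈ s, P x := by
  simp

namespace KripkeModel

variable (M : KripkeModel.{u, w} Atm)

theorem forces_single (x : M.World) (Γ Δ : Multiset (Formula Atm)) :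
    M.Forces x (LNS.single ⟨Γ, Δ⟩).toFormula ↔
      ((∀ A ∈ Γ, M.Forces x A) → ∃ A ∈ Δ, M.Forces x A) := by
  simp only [LNS.toFormula, Forces, forces_conj, forces_disj]

theorem forces_cons (x : M.World) (Γ Δ : Multiset (Formula Atm)) (S : LNS Atm) :
    M.Forces x (LNS.cons ⟨Γ, Δ⟩ S).toFormula ↔
      ((∀ A ∈ Γ, M.Forces x A) →
        (∃ A ∈ Δ, M.Forces x A) ∨ ∀ y, M.R x y → M.Forces y S.toFormula) := by
  simp only [LNS.toFormula, Forces, forces_conj, forces_disj, forces_or]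

theorem forces_plug {S : LNS Atm} (h : ∀ x, M.Forces x S.toFormula) (G : List (Component Atm)) :
    ∀ x, M.Forces x (LNS.plug G S).toFormula := by
  induction G with
  | nil => exact h
  | cons c G ih => exact fun x => (M.forces_cons x _ _ _).2 fun _ => Or.inr fun y _ => ih y

/-- The plugged sequent occurs positively, under boxes and disjunctions, in the translation. Two
premisses are needed for `impL`. -/
theorem forces_plug_mono₂ {S₁ S₂ S : LNS Atm}
    (h : ∀ x, M.Forces x S₁.toFormula → M.Forces x S₂.toFormula → M.Forces x S.toFormula)
    (G : List (Component Atm)) :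
    ∀ x, M.Forces x (LNS.plug G S₁).toFormula → M.Forces x (LNS.plug G S₂).toFormula →
      M.Forces x (LNS.plug G S).toFormula := by
  induction G with
  | nil => exact h
  | cons c G ih =>
    intro x h₁ h₂
    refine (M.forces_cons x _ _ _).2 fun hc => ?_
    rcases (M.forces_cons x _ _ _).1 h₁ hc with h' | h₁
    · exact Or.inl h'
    rcases (M.forces_cons x _ _ _).1 h₂ hc with h' | h₂
    · exact Or.inl h'
    exact Or.inr fun y hy => ih y (h₁ y hy) (h₂ y hy)

theorem forces_plug_mono {S₁ S : LNS Atm}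
    (h : ∀ x, M.Forces x S₁.toFormula → M.Forces x S.toFormula)
    (G : List (Component Atm)) (x : M.World) (h₁ : M.Forces x (LNS.plug G S₁).toFormula) :
    M.Forces x (LNS.plug G S).toFormula :=
  M.forces_plug_mono₂ (fun x h' _ => h x h') G x h₁ h₁

end KripkeModel

theorem Derivable.forces {S : LNS Atm} (h : Derivable S) (M : KripkeModel.{u, w} Atm)
    (hM : M.IsSymmetric) : ∀ x, M.Forces x S.toFormula := by
  induction h with
  | id G Γ Δ p =>
    refine M.forces_plug (fun x => ?_) G
    simp only [M.forces_single, Multiset.forall_mem_cons, exists_mem_cons_iff]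
    tauto
  | botL G Γ Δ =>
    refine M.forces_plug (fun x => ?_) G
    simp only [M.forces_single, Multiset.forall_mem_cons, KripkeModel.Forces]
    tauto
  | ew G Γ Δ Sg Pi _ ih =>
    refine fun x => M.forces_plug_mono (fun x => ?_) G x (ih x)
    simp only [M.forces_single, M.forces_cons]
    exact fun h hΓ => Or.inl (h hΓ)
  | impR G Γ Δ A B _ ih =>
    refine fun x => M.forces_plug_mono (fun x => ?_) G x (ih x)
    simp only [M.forces_single, Multiset.forall_mem_cons, exists_mem_cons_iff,
      KripkeModel.Forces]
    tauto
  | impL G Γ Δ A B _ _ ih₁ ih₂ =>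
    refine fun x => M.forces_plug_mono₂ (fun x => ?_) G x (ih₁ x) (ih₂ x)
    simp only [M.forces_single, Multiset.forall_mem_cons, exists_mem_cons_iff,
      KripkeModel.Forces]
    tauto
  | boxR G Γ Δ A _ ih =>
    refine fun x => M.forces_plug_mono (fun x => ?_) G x (ih x)
    simp only [M.forces_single, M.forces_cons, exists_mem_cons_iff, KripkeModel.Forces,
      Multiset.notMem_zero, Multiset.mem_singleton, exists_eq_left, false_imp_iff, implies_true,
      true_imp_iff]
    tauto
  | boxL1 G Γ Δ Sg Pi A _ ih =>
    refine fun x => M.forces_plug_mono (fun x => ?_) G x (ih x)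
    simp only [M.forces_single, M.forces_cons, Multiset.forall_mem_cons, KripkeModel.Forces]
    rintro h ⟨hA, hΓ⟩
    exact (h ⟨hA, hΓ⟩).imp_right fun h y hy hS => h y hy ⟨hA y hy, hS⟩
  | boxL2 G Γ Δ Sg Pi A _ ih =>
    refine fun x => M.forces_plug_mono (fun x => ?_) G x (ih x)
    simp only [M.forces_single, M.forces_cons, Multiset.forall_mem_cons, KripkeModel.Forces]
    intro h hΓ
    by_cases hA : M.Forces x A
    · exact Or.inl (h ⟨hA, hΓ⟩)
    -- The only use of symmetry: `y` sees `x`, so the box cannot hold at `y` when `A` fails at `x`.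
    · exact Or.inr fun y hy hS => absurd (hS.1 x (hM x y hy)) hA

theorem Derivable.valid {S : LNS Atm} (h : Derivable S) : LNS.Valid.{u, w} S :=
  fun ⟨M, hM, x, hx⟩ => hx (h.forces M hM x)

/-! ### Subformulae -/

namespace Formula

/-- The set of subformulae of a formula. -/
def subformulae : Formula Atm → Set (Formula Atm)
  | atom p => {atom p}
  | bot => {bot}
  | imp A B => insert (imp A B) (subformulae A ∪ subformulae B)
  | box A => insert (box A) (subformulae A)

theorem self_mem_subformulae (A : Formula Atm) : A ∈ A.subformulae := by
  cases A <;> simp [subformulae]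

theorem finite_subformulae (A : Formula Atm) : A.subformulae.Finite := by
  induction A with
  | atom p => exact Set.finite_singleton _
  | bot => exact Set.finite_singleton _
  | imp A B hA hB => exact (hA.union hB).insert _
  | box A hA => exact hA.insert _

/-- A set of formulae closed under immediate subformulae. -/
structure IsClosed (F : Set (Formula Atm)) : Prop where
  left_mem : ∀ {A B}, imp A B ∈ F → A ∈ F
  right_mem : ∀ {A B}, imp A B ∈ F → B ∈ F
  box_mem : ∀ {A}, box A ∈ F → A ∈ F

theorem isClosed_subformulae (C : Formula Atm) : IsClosed C.subformulae := by
  induction C with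
  | atom p => constructor <;> simp [subformulae]
  | bot => constructor <;> simp [subformulae]
  | imp C D hC hD =>
    constructor
    · rintro A B (h | h | h)
      · cases h; exact Or.inr (Or.inl (self_mem_subformulae _))
      · exact Or.inr (Or.inl (hC.left_mem h))
      · exact Or.inr (Or.inr (hD.left_mem h))
    · rintro A B (h | h | h)
      · cases h; exact Or.inr (Or.inr (self_mem_subformulae _))
      · exact Or.inr (Or.inl (hC.right_mem h))
      · exact Or.inr (Or.inr (hD.right_mem h))
    · rintro A (h | h | h)
      · cases h
      · exact Or.inr (Or.inl (hC.box_mem h))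
      · exact Or.inr (Or.inr (hD.box_mem h))
  | box C hC =>
    constructor
    · rintro A B (h | h)
      · cases h
      · exact Or.inr (hC.left_mem h)
    · rintro A B (h | h)
      · cases h
      · exact Or.inr (hC.right_mem h)
    · rintro A (h | h)
      · cases h; exact Or.inr (self_mem_subformulae _)
      · exact Or.inr (hC.box_mem h)

theorem exists_finite_isClosed (Γ : Multiset (Formula Atm)) :
    ∃ F : Set (Formula Atm), F.Finite ∧ IsClosed F ∧ ∀ A ∈ Γ, A ∈ F := by
  refine ⟨⋃ A ∈ {A | A ∈ Γ}, A.subformulae,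
    (Multiset.finite_toSet Γ).biUnion fun A _ => A.finite_subformulae, ?_,
    fun A hA => Set.mem_biUnion hA A.self_mem_subformulae⟩
  constructor <;> intros <;> simp only [Set.mem_iUnion] at * <;>
    obtain ⟨C, hC, h⟩ := ‹_›
  · exact ⟨C, hC, C.isClosed_subformulae.left_mem h⟩
  · exact ⟨C, hC, C.isClosed_subformulae.right_mem h⟩
  · exact ⟨C, hC, C.isClosed_subformulae.box_mem h⟩

end Formula

/-! ### Maximal underivable components -/

theorem LNS.plug_append (G H : List (Component Atm)) (S : LNS Atm) :
    plug (G ++ H) S = plug G (plug H S) := by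
  induction G with
  | nil => rfl
  | cons c G ih => exact congrArg (LNS.cons c) ih

theorem LNS.end1_append_singleton (G : List (Component Atm)) (Γ Δ Sg Pi : Multiset (Formula Atm)) :
    end1 (G ++ [⟨Γ, Δ⟩]) Sg Pi = end2 G Γ Δ Sg Pi :=
  plug_append _ _ _

namespace Component

/-- All formulae of the component lie in `F`. -/
def Within (F : Set (Formula Atm)) (c : Component Atm) : Prop :=
  (∀ A ∈ c.ant, A ∈ F) ∧ ∀ A ∈ c.suc, A ∈ F

/-- Inclusion of the underlying sets of formulae. -/
def Sub (c d : Component Atm) : Prop :=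
  (∀ A ∈ c.ant, A ∈ d.ant) ∧ ∀ A ∈ c.suc, A ∈ d.suc

/-- `c` is underivable at the end of the context `G`, and its underlying sets of formulae are
maximal with this property among the components over `F`. -/
structure IsMaximal (F : Set (Formula Atm)) (G : List (Component Atm)) (c : Component Atm) :
    Prop where
  within : c.Within F
  not_derivable : ¬ Derivable (LNS.end1 G c.ant c.suc)
  sub_of_sub : ∀ d : Component Atm, d.Within F → ¬ Derivable (LNS.end1 G d.ant d.suc) →
    c.Sub d → d.Sub c

/-- There are infinitely many multisets over `F`, but only finitely many pairs of underlying sets,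
so a maximal pair exists. -/
theorem exists_isMaximal {F : Set (Formula Atm)} (hF : F.Finite) (G : List (Component Atm))
    {c : Component Atm} (hc : c.Within F) (hd : ¬ Derivable (LNS.end1 G c.ant c.suc)) :
    ∃ d : Component Atm, c.Sub d ∧ d.IsMaximal F G := by
  let supp : Component Atm → Set (Formula Atm) × Set (Formula Atm) :=
    fun d => ({A | A ∈ d.ant}, {A | A ∈ d.suc})
  let T := supp '' {d | d.Within F ∧ ¬ Derivable (LNS.end1 G d.ant d.suc)}
  have hT : T.Finite := (hF.finite_subsets.prod hF.finite_subsets).subset <| by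
    rintro _ ⟨d, ⟨hd, -⟩, rfl⟩
    exact hd
  obtain ⟨_, hle, ⟨⟨d, ⟨hdF, hdd⟩, rfl⟩, hmax⟩⟩ :=
    hT.exists_le_maximal (a := supp c) ⟨c, ⟨hc, hd⟩, rfl⟩
  exact ⟨d, hle, hdF, hdd, fun e he hed hde => hmax ⟨e, ⟨he, hed⟩, rfl⟩ hde⟩

namespace IsMaximal

variable {F : Set (Formula Atm)} {G : List (Component Atm)} {Γ Δ Sg Pi : Multiset (Formula Atm)}
  {A B : Formula Atm}

theorem mem_ant (h : IsMaximal F G ⟨Γ, Δ⟩) (hA : A ∈ F)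
    (hd : ¬ Derivable (LNS.end1 G (A ::ₘ Γ) Δ)) : A ∈ Γ :=
  (h.sub_of_sub ⟨A ::ₘ Γ, Δ⟩ ⟨Multiset.forall_mem_cons.2 ⟨hA, h.within.1⟩, h.within.2⟩ hd
    ⟨fun _ => Multiset.mem_cons_of_mem, fun _ => id⟩).1 A (Multiset.mem_cons_self A Γ)

theorem mem_suc (h : IsMaximal F G ⟨Γ, Δ⟩) (hA : A ∈ F)
    (hd : ¬ Derivable (LNS.end1 G Γ (A ::ₘ Δ))) : A ∈ Δ :=
  (h.sub_of_sub ⟨Γ, A ::ₘ Δ⟩ ⟨h.within.1, Multiset.forall_mem_cons.2 ⟨hA, h.within.2⟩⟩ hd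
    ⟨fun _ => id, fun _ => Multiset.mem_cons_of_mem⟩).2 A (Multiset.mem_cons_self A Δ)

theorem atom_notMem (h : IsMaximal F G ⟨Γ, Δ⟩) {p : Atm} (hp : Formula.atom p ∈ Γ) :
    Formula.atom p ∉ Δ := by
  intro hq
  obtain ⟨Γ, rfl⟩ := Multiset.exists_cons_of_mem hp
  obtain ⟨Δ, rfl⟩ := Multiset.exists_cons_of_mem hq
  exact h.not_derivable (.id G Γ Δ p)

theorem bot_notMem (h : IsMaximal F G ⟨Γ, Δ⟩) : Formula.bot ∉ Γ := by
  intro hp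
  obtain ⟨Γ, rfl⟩ := Multiset.exists_cons_of_mem hp
  exact h.not_derivable (.botL G Γ Δ)

/-- The premiss of `impR` adds both formulae, so maximality is applied to the joint extension;
adding them one at a time would require weakening. -/
theorem of_imp_mem_suc (h : IsMaximal F G ⟨Γ, Δ⟩) (hF : Formula.IsClosed F)
    (hm : Formula.imp A B ∈ Δ) : A ∈ Γ ∧ B ∈ Δ := by
  have hAB := h.within.2 _ hm
  have hs := h.sub_of_sub ⟨A ::ₘ Γ, B ::ₘ Δ⟩
    ⟨Multiset.forall_mem_cons.2 ⟨hF.left_mem hAB, h.within.1⟩,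
      Multiset.forall_mem_cons.2 ⟨hF.right_mem hAB, h.within.2⟩⟩
    (by
      intro hd
      obtain ⟨Δ, rfl⟩ := Multiset.exists_cons_of_mem hm
      exact h.not_derivable (.impR G Γ Δ A B hd))
    ⟨fun _ => Multiset.mem_cons_of_mem, fun _ => Multiset.mem_cons_of_mem⟩
  exact ⟨hs.1 A (Multiset.mem_cons_self A Γ), hs.2 B (Multiset.mem_cons_self B Δ)⟩

theorem of_imp_mem_ant (h : IsMaximal F G ⟨Γ, Δ⟩) (hF : Formula.IsClosed F)
    (hm : Formula.imp A B ∈ Γ) : B ∈ Γ ∨ A ∈ Δ := by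
  have hAB := h.within.1 _ hm
  by_cases hB : Derivable (LNS.end1 G (B ::ₘ Γ) Δ)
  · refine Or.inr (h.mem_suc (hF.left_mem hAB) fun hA => ?_)
    obtain ⟨Γ, rfl⟩ := Multiset.exists_cons_of_mem hm
    exact h.not_derivable (.impL G Γ Δ A B hB hA)
  · exact Or.inl (h.mem_ant (hF.right_mem hAB) hB)

/-- By `boxR` the fresh component with only `A` on the right is underivable; it is then enlarged to
a maximal one. -/
theorem exists_of_box_mem_suc (h : IsMaximal F G ⟨Γ, Δ⟩) (hF : Formula.IsClosed F)
    (hfin : F.Finite) (hm : Formula.box A ∈ Δ) :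
    ∃ d : Component Atm, IsMaximal F (G ++ [⟨Γ, Δ⟩]) d ∧ A ∈ d.suc := by
  obtain ⟨d, hcd, hd⟩ := exists_isMaximal hfin (G ++ [⟨Γ, Δ⟩]) (c := ⟨0, {A}⟩)
    ⟨by simp, by simpa using hF.box_mem (h.within.2 _ hm)⟩
    (by
      rw [LNS.end1_append_singleton]
      intro hd
      obtain ⟨Δ, rfl⟩ := Multiset.exists_cons_of_mem hm
      exact h.not_derivable (.boxR G Γ Δ A hd))
  exact ⟨d, hd, hcd.2 A (Multiset.mem_singleton_self A)⟩

theorem mem_child (hc : IsMaximal F (G ++ [⟨Γ, Δ⟩]) ⟨Sg, Pi⟩)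
    (hA : A ∈ F) (hm : Formula.box A ∈ Γ) : A ∈ Sg := by
  refine hc.mem_ant hA fun hd => hc.not_derivable ?_
  rw [LNS.end1_append_singleton] at hd ⊢
  obtain ⟨Γ, rfl⟩ := Multiset.exists_cons_of_mem hm
  exact .boxL1 G Γ Δ Sg Pi A hd

/-- If adding `A` to the parent gave a derivable sequent, `boxL2` would derive the child. This is
the syntactic counterpart of symmetry. -/
theorem mem_parent (h : IsMaximal F G ⟨Γ, Δ⟩) (hc : IsMaximal F (G ++ [⟨Γ, Δ⟩]) ⟨Sg, Pi⟩)
    (hA : A ∈ F) (hm : Formula.box A ∈ Sg) : A ∈ Γ := by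
  refine h.mem_ant hA fun hd => hc.not_derivable ?_
  rw [LNS.end1_append_singleton]
  obtain ⟨Sg, rfl⟩ := Multiset.exists_cons_of_mem hm
  exact .boxL2 G Γ Δ Sg Pi A hd

end IsMaximal

theorem countable_within {F : Set (Formula Atm)} (hF : F.Countable) :
    {c : Component Atm | c.Within F}.Countable := by
  have : Countable F := hF.to_subtype
  refine (Set.countable_range fun p : Multiset F × Multiset F =>
    (⟨p.1.map Subtype.val, p.2.map Subtype.val⟩ : Component Atm)).mono ?_
  rintro ⟨Γ, Δ⟩ ⟨hΓ, hΔ⟩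
  lift Γ to Multiset F using hΓ
  lift Δ to Multiset F using hΔ
  exact ⟨(Γ, Δ), rfl⟩

end Component

/-! ### The canonical model -/

/-- The worlds of the canonical model over `F`: linear nested sequents over `F` whose last
component is maximal. -/
def canonicalWorlds (F : Set (Formula Atm)) : Set (List (Component Atm) × Component Atm) :=
  {x | (∀ d ∈ x.1, d.Within F) ∧ x.2.IsMaximal F x.1}

/-- Contexts have unbounded length, so finiteness may fail; countability suffices for changing
universes. -/
theorem countable_canonicalWorlds {F : Set (Formula Atm)} (hF : F.Countable) :
    (canonicalWorlds F).Countable := by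
  have hC := Component.countable_within hF
  have : Countable {c : Component Atm | c.Within F} := hC.to_subtype
  refine ((Set.countable_range
    (List.map (Subtype.val : {c : Component Atm | c.Within F} → _))).prod hC).mono ?_
  rintro ⟨G, c⟩ ⟨hG, hc⟩
  refine ⟨?_, hc.within⟩
  lift G to List {c : Component Atm | c.Within F} using hG
  exact ⟨G, rfl⟩

/-- The canonical model over `F`: a world is related to the worlds that extend it by one component,
and to the world that it extends by one component. -/
def canonicalModel (F : Set (Formula Atm)) (h : Nonempty (canonicalWorlds F)) :
    KripkeModel.{u, u} Atm where
  World := canonicalWorlds F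
  nonempty := h
  R x y := y.1.1 = x.1.1 ++ [x.1.2] ∨ x.1.1 = y.1.1 ++ [y.1.2]
  V x p := Formula.atom p ∈ x.1.2.ant

theorem canonicalModel_isSymmetric (F : Set (Formula Atm)) (h : Nonempty (canonicalWorlds F)) :
    (canonicalModel F h).IsSymmetric :=
  fun _ _ => Or.symm

theorem canonicalModel_truth {F : Set (Formula Atm)} (hF : Formula.IsClosed F) (hfin : F.Finite)
    (h : Nonempty (canonicalWorlds F)) (A : Formula Atm) :
    ∀ x : canonicalWorlds F, (A ∈ x.1.2.ant → (canonicalModel F h).Forces x A) ∧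
      (A ∈ x.1.2.suc → ¬ (canonicalModel F h).Forces x A) := by
  induction A with
  | atom p => exact fun x => ⟨id, fun hs ha => x.2.2.atom_notMem ha hs⟩
  | bot => exact fun x => ⟨fun ha => (x.2.2.bot_notMem ha).elim, fun _ => id⟩
  | imp A B ihA ihB =>
    refine fun x => ⟨fun hm hA => ?_, fun hm hAB => ?_⟩
    · rcases x.2.2.of_imp_mem_ant hF hm with hB | hA'
      · exact (ihB x).1 hB
      · exact absurd hA ((ihA x).2 hA')
    · obtain ⟨hA, hB⟩ := x.2.2.of_imp_mem_suc hF hm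
      exact (ihB x).2 hB (hAB ((ihA x).1 hA))
  | box A ih =>
    rintro ⟨⟨G, c⟩, hG, hc⟩
    refine ⟨?_, fun hm hA => ?_⟩
    -- A neighbour is either a child (`mem_child`) or the parent (`mem_parent`).
    · rintro hm ⟨⟨H, d⟩, hH, hd⟩ (hR | hR) <;> refine (ih _).1 ?_
      · obtain rfl : H = G ++ [c] := hR
        exact hd.mem_child (hF.box_mem (hc.within.1 _ hm)) hm
      · obtain rfl : G = H ++ [d] := hR
        exact hd.mem_parent hc (hF.box_mem (hc.within.1 _ hm)) hm
    · obtain ⟨d, hd, hAd⟩ := hc.exists_of_box_mem_suc hF hfin hm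
      refine (ih ⟨(G ++ [c], d), ?_, hd⟩).2 hAd (hA _ (Or.inl rfl))
      intro e he
      rcases List.mem_append.1 he with he | he
      · exact hG e he
      · exact List.mem_singleton.1 he ▸ hc.within

/-! ### Transfer of models between universes -/

namespace KripkeModel

universe v

/-- A copy of a small model in another universe. -/
noncomputable def shrink (M : KripkeModel.{u, v} Atm) [Small.{w} M.World] :
    KripkeModel.{u, w} Atm where
  World := Shrink.{w} M.World
  nonempty := M.nonempty.map (equivShrink M.World)
  R x y := M.R ((equivShrink M.World).symm x) ((equivShrink M.World).symm y)
  V x p := M.V ((equivShrink M.World).symm x) p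

theorem forces_shrink (M : KripkeModel.{u, v} Atm) [Small.{w} M.World] (A : Formula Atm) :
    ∀ x : Shrink.{w} M.World,
      (shrink.{u, w, v} M).Forces x A ↔ M.Forces ((equivShrink M.World).symm x) A := by
  induction A with
  | atom p => exact fun x => Iff.rfl
  | bot => exact fun x => Iff.rfl
  | imp A B ihA ihB => exact fun x => imp_congr (ihA x) (ihB x)
  | box A ih =>
    exact fun x => (forall_congr' fun y => imp_congr Iff.rfl (ih y)).trans
      ((equivShrink M.World).symm.forall_congr_right
        (q := fun y => M.R ((equivShrink M.World).symm x) y → M.Forces y A))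

end KripkeModel

/-! ### Completeness -/

theorem derivable_single_of_valid {Γ Δ : Multiset (Formula Atm)}
    (h : LNS.Valid.{u, w} (LNS.single ⟨Γ, Δ⟩)) : Derivable (LNS.single ⟨Γ, Δ⟩) := by
  by_contra hd
  obtain ⟨F, hfin, hF, hΓΔ⟩ := Formula.exists_finite_isClosed (Γ + Δ)
  obtain ⟨c, hsub, hc⟩ := Component.exists_isMaximal hfin [] (c := ⟨Γ, Δ⟩)
    ⟨fun A hA => hΓΔ A (Multiset.mem_add.2 (Or.inl hA)),
      fun A hA => hΓΔ A (Multiset.mem_add.2 (Or.inr hA))⟩ hd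
  let x : canonicalWorlds F := ⟨([], c), by simp, hc⟩
  let M := canonicalModel F ⟨x⟩
  let x' : M.World := x
  -- Countable types are small in every universe, which is what `shrink` requires.
  have : Countable M.World := (countable_canonicalWorlds hfin.countable).to_subtype
  have truth := fun A => canonicalModel_truth hF hfin ⟨x⟩ A x
  refine h ⟨KripkeModel.shrink.{u, w, u} M, fun y z => canonicalModel_isSymmetric F ⟨x⟩ _ _, equivShrink.{w} M.World x', ?_⟩
  rw [KripkeModel.forces_shrink.{u, w, u}, Equiv.symm_apply_apply, KripkeModel.forces_single]
  intro hx
  obtain ⟨A, hA, hxA⟩ := hx fun A hA => (truth A).1 (hsub.1 A hA)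
  exact (truth A).2 (hsub.2 A hA) hxA

theorem valid_single_iff_mem_KB (A : Formula Atm) :
    LNS.Valid.{u, w} (LNS.single ⟨0, {A}⟩) ↔ A ∈ KB.{u, w} Atm := by
  simp [LNS.Valid, LNS.Falsifiable, KB, KripkeModel.forces_single]

end LNSKB

theorem mainTheorem7 (Atm : Type u) :
    (∀ S : LNSKB.LNS Atm, LNSKB.Derivable S → LNSKB.LNS.Valid.{u, w} S) ∧
    (∀ Γ Δ : Multiset (LNSKB.Formula Atm),
      LNSKB.LNS.Valid.{u, w} (LNSKB.LNS.single ⟨Γ, Δ⟩) →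
        LNSKB.Derivable (LNSKB.LNS.single ⟨Γ, Δ⟩)) ∧
    (∀ A : LNSKB.Formula Atm,
      LNSKB.Derivable (LNSKB.LNS.single ⟨0, {A}⟩) ↔ A ∈ LNSKB.KB.{u, w} Atm) :=
  ⟨fun _ h => h.valid, fun _ _ h => LNSKB.derivable_single_of_valid h, fun A =>
    ⟨fun h => (LNSKB.valid_single_iff_mem_KB A).1 h.valid,
      fun h => LNSKB.derivable_single_of_valid ((LNSKB.valid_single_iff_mem_KB A).2 h)⟩⟩
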